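/- **Theorem 6.9 (linear convergence of softmax policy gradient with entropy regularization).** Let $\mathcal M=(\mathcal S,\mathcal A,P,r,\gamma)$ be a discounted Markov decision process with finite nonempty $\mathcal S,\mathcal A$, discount factor $\gamma\in[0,1)$ and rewards $r(s,a)\in[0,1]$, and let $\tau>0$. For a policy $\pi$ put $$V_\tau^\pi(s)=\mathbb E\Big[\sum_{t\ge 0}\gamma^t\big(r(s_t,a_t)-\tau\log\pi(a_t|s_t)\big)\,\Big|\,s_0=s,\pi\Big],\qquad V_\tau^*(s)=\sup_\pi V_\tau^\pi(s),\qquad V_\tau^\pi(\mu)=\sum_s\mu(s)V_\tau^\pi(s).$$ Then the equation $$\exp\Big(-\frac{2x(1+\tau\log|\mathcal A|)}{(1-\gamma)^2}\Big)=\frac{\tau x}{2(1-\gamma)},\qquad x\in\mathbb R,$$ has a unique root $\beta$, and $\beta>2\alpha$ for $\alpha=\frac{(1-\gamma)^3}{8+\tau(4+8\log|\mathcal A|)}$, so that $(0,\beta)$ contains the previously known range $(0,2\alpha]$ of step sizes. Let $\mu$ be a distribution on $\mathcal S$ with $\tilde\mu:=\min_s\mu(s)>0$, let $\eta\in(0,\beta)$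 and $\theta^0\in\mathbb R^{\mathcal S\times\mathcal A}$, let $\pi_\theta(a|s)=\exp(\theta_{s,a})/\sum_{a'}\exp(\theta_{s,a'})$, and let $$\theta^{k+1}=\theta^k+\eta\,\nabla_\theta V_\tau^{\pi_\theta}(\mu)\big|_{\theta=\theta^k},\qquad \pi^k=\pi_{\theta^k},\qquad V_\tau^k=V_\tau^{\pi^k}\qquad(k\ge 0).$$ Then $\kappa:=\inf_{k\ge 0}\min_{s,a}\pi^k(a|s)>0$, the number $$\varrho:=1-(1-\gamma)\,\eta\,\tilde\mu\,\tau\,\kappa^2\Big[2\exp\Big(-\frac{2\eta(1+\tau\log|\mathcal A|)}{(1-\gamma)^2}\Big)-\frac{\tau\eta}{1-\gamma}\Big]$$ lies in $(0,1)$, and for all $k\ge 0$ $$\|V_\tau^*-V_\tau^k\|_\infty\le\varrho^k\,\|V_\tau^*-V_\tau^0\|_\infty .$$ -/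

import Mathlib

open MeasureTheory ProbabilityTheory

noncomputable section

namespace EntropyPG

/-- The measure on a finite type `ι` with mass function `p ∈ Δ(ι)`. -/
def simplexMeasure {ι : Type*} [Fintype ι] [MeasurableSpace ι] (p : stdSimplex ℝ ι) :
    Measure ι :=
  ∑ i, ENNReal.ofReal (p.1 i) • Measure.dirac i

instance {ι : Type*} [Fintype ι] [MeasurableSpace ι] (p : stdSimplex ℝ ι) :
    IsProbabilityMeasure (simplexMeasure p) := by
  refine ⟨?_⟩
  simp only [simplexMeasure, Measure.coe_finsetSum, Finset.sum_apply, Measure.smul_apply,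
    measure_univ, smul_eq_mul, mul_one]
  rw [← ENNReal.ofReal_sum_of_nonneg (fun i _ => p.2.1 i), p.2.2, ENNReal.ofReal_one]

/-- A finite discounted Markov decision process `(S, A, P, r, γ)` with rewards in `[0, 1]`;
`P s a` is the distribution `P(· | s, a)` of the next state. -/
structure FiniteMDP (S A : Type*) [Fintype S] [Fintype A] where
  P : S → A → stdSimplex ℝ S
  r : S → A → ℝ
  r_mem : ∀ s a, r s a ∈ Set.Icc (0 : ℝ) 1
  γ : ℝ
  γ_nonneg : 0 ≤ γ
  γ_lt_one : γ < 1

/-- The set `Π` of all admissible (stationary randomized) policies; `π s a` is `π(a | s)`. -/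
abbrev Policy (S A : Type*) [Fintype A] := S → stdSimplex ℝ A

section Values

variable {S A : Type*} [Fintype S] [MeasurableSpace S] [DiscreteMeasurableSpace S]
  [Fintype A] [MeasurableSpace A] [DiscreteMeasurableSpace A]

/-- The policy as a Markov kernel from states to actions. -/
def policyKernel (π : Policy S A) : Kernel S A where
  toFun s := simplexMeasure (π s)
  measurable' := Measurable.of_discrete

instance (π : Policy S A) : IsMarkovKernel (policyKernel π) :=
  ⟨fun s => inferInstanceAs (IsProbabilityMeasure (simplexMeasure (π s)))⟩

/-- The transition probabilities as a Markov kernel from state-action pairs to states. -/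
def transitionKernel (M : FiniteMDP S A) : Kernel (S × A) S where
  toFun x := simplexMeasure (M.P x.1 x.2)
  measurable' := Measurable.of_discrete

instance (M : FiniteMDP S A) : IsMarkovKernel (transitionKernel M) :=
  ⟨fun x => inferInstanceAs (IsProbabilityMeasure (simplexMeasure (M.P x.1 x.2)))⟩

/-- One step of the state-action process under `π`: from `(s, a)`, draw `s' ∼ P(· | s, a)` and
then `a' ∼ π(· | s')`. -/
def stepKernel (M : FiniteMDP S A) (π : Policy S A) : Kernel (S × A) (S × A) :=
  transitionKernel M ⊗ₖ Kernel.prodMkLeft (S × A) (policyKernel π)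

instance (M : FiniteMDP S A) (π : Policy S A) : IsMarkovKernel (stepKernel M π) :=
  inferInstanceAs
    (IsMarkovKernel (transitionKernel M ⊗ₖ Kernel.prodMkLeft (S × A) (policyKernel π)))

/-- The transition at time `n`, as a kernel on histories: only the last pair `(s_n, a_n)` of the
history matters. -/
def historyKernel (M : FiniteMDP S A) (π : Policy S A) (n : ℕ) :
    Kernel (Finset.Iic n → S × A) (S × A) :=
  (stepKernel M π).comap (fun h => h ⟨n, Finset.mem_Iic.2 le_rfl⟩) (measurable_pi_apply _)

instance (M : FiniteMDP S A) (π : Policy S A) (n : ℕ) : IsMarkovKernel (historyKernel M π n) :=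
  inferInstanceAs (IsMarkovKernel ((stepKernel M π).comap
    (fun h : Finset.Iic n → S × A => h ⟨n, Finset.mem_Iic.2 le_rfl⟩) (measurable_pi_apply _)))

/-- The law of the random trajectory `(s_0, a_0), (s_1, a_1), …` given `s_0 = s` and the policy
`π`. -/
def trajLaw (M : FiniteMDP S A) (π : Policy S A) (s : S) : Measure (ℕ → S × A) :=
  Kernel.trajMeasure (X := fun _ => S × A) (Measure.dirac s ⊗ₘ policyKernel π)
    (historyKernel M π)

/-- The entropy regularized state value
`V_τ^π(s) = 𝔼[∑ₜ γᵗ (r(s_t, a_t) - τ log π(a_t | s_t)) | s_0 = s, π]`. -/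
def value (M : FiniteMDP S A) (τ : ℝ) (π : Policy S A) (s : S) : ℝ :=
  ∫ ω : ℕ → S × A,
    ∑' t : ℕ, M.γ ^ t * (M.r (ω t).1 (ω t).2 - τ * Real.log ((π (ω t).1).1 (ω t).2))
    ∂(trajLaw M π s)

/-- `V_τ^π(μ) = 𝔼_{s ∼ μ}[V_τ^π(s)]`. -/
def valueAt (M : FiniteMDP S A) (τ : ℝ) (π : Policy S A) (μ : stdSimplex ℝ S) : ℝ :=
  ∑ s, μ.1 s * value M τ π s

/-- The optimal entropy regularized state value `V_τ^*(s)`, the supremum of `V_τ^π(s)` over all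
policies `π`. -/
def optValue (M : FiniteMDP S A) (τ : ℝ) (s : S) : ℝ :=
  ⨆ π : Policy S A, value M τ π s

/-- The softmax policy `π_θ(a | s) = exp θ_{s,a} / ∑_{a'} exp θ_{s,a'}`. -/
def softmax [Nonempty A] (θ : EuclideanSpace ℝ (S × A)) : Policy S A := fun s =>
  ⟨fun a => Real.exp (θ (s, a)) / ∑ a', Real.exp (θ (s, a')), by
    have h : 0 < ∑ a', Real.exp (θ (s, a')) :=
      Finset.sum_pos (fun a _ => Real.exp_pos _) Finset.univ_nonempty
    refine ⟨fun a => by positivity, ?_⟩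
    rw [← Finset.sum_div, div_self h.ne']⟩

/-- The parameters `θ^k` of softmax policy gradient with entropy regularization: gradient ascent
`θ^{k+1} = θ^k + η ∇_θ V_τ^{π_θ}(μ)|_{θ = θ^k}` with constant step size `η`, started at `θ^0`. -/
def softmaxPG [Nonempty A] (M : FiniteMDP S A) (τ : ℝ) (μ : stdSimplex ℝ S) (η : ℝ)
    (θ₀ : EuclideanSpace ℝ (S × A)) : ℕ → EuclideanSpace ℝ (S × A)
  | 0 => θ₀
  | k + 1 => softmaxPG M τ μ η θ₀ k +
      η • gradient (fun θ => valueAt M τ (softmax θ) μ) (softmaxPG M τ μ η θ₀ k)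

end Values

end EntropyPG

end

noncomputable section

namespace EntropyPG

lemma integral_simplexMeasure {ι : Type*} [Fintype ι] [MeasurableSpace ι]
    [DiscreteMeasurableSpace ι] (p : stdSimplex ℝ ι) (f : ι → ℝ) :
    ∫ i, f i ∂(simplexMeasure p) = ∑ i, p.1 i * f i := by
  unfold simplexMeasure
  rw [integral_finsetSum_measure]
  · refine Finset.sum_congr rfl fun i _ => ?_
    rw [integral_smul_measure, integral_dirac, ENNReal.toReal_ofReal (p.2.1 i), smul_eq_mul]
  · intro i _
    exact (integrable_dirac (by simp)).smul_measure ENNReal.ofReal_ne_top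

section Bellman

variable {S A : Type*} [Fintype S] [Fintype A]

/-- Expectation of a function of the action under `π(· | s)`. -/
def avg (π : Policy S A) (f : S → A → ℝ) (s : S) : ℝ := ∑ a, (π s).1 a * f s a

/-- Expectation of a function of the next state under `P(· | s, a)`. -/
def nextVal (M : FiniteMDP S A) (v : S → ℝ) (s : S) (a : A) : ℝ := ∑ s', (M.P s a).1 s' * v s'

/-- The one-step transition operator on state functions under `π`. -/
def stepOp (M : FiniteMDP S A) (π : Policy S A) (v : S → ℝ) : S → ℝ := avg π (nextVal M v)

/-- The entropy regularized one-step reward of a state. -/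
def regReward (M : FiniteMDP S A) (τ : ℝ) (π : Policy S A) : S → ℝ :=
  avg π fun s a => M.r s a - τ * Real.log ((π s).1 a)

lemma stepOp_hasSum (M : FiniteMDP S A) (π : Policy S A) {v : ℕ → S → ℝ} {w : S → ℝ}
    (h : ∀ s, HasSum (fun t => v t s) (w s)) (s : S) :
    HasSum (fun t => stepOp M π (v t) s) (stepOp M π w s) := by
  unfold stepOp avg nextVal
  exact hasSum_sum fun a _ => (hasSum_sum fun s' _ => (h s').mul_left _).mul_left _

lemma stepOp_smul (M : FiniteMDP S A) (π : Policy S A) (c : ℝ) (v : S → ℝ) (s : S) :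
    stepOp M π (fun s => c * v s) s = c * stepOp M π v s := by
  simp only [stepOp, avg, nextVal, Finset.mul_sum]
  refine Finset.sum_congr rfl fun a _ => Finset.sum_congr rfl fun s' _ => by ring

variable [MeasurableSpace S] [DiscreteMeasurableSpace S]
  [MeasurableSpace A] [DiscreteMeasurableSpace A]

instance (M : FiniteMDP S A) (π : Policy S A) (s : S) : IsProbabilityMeasure (trajLaw M π s) := by
  unfold trajLaw; infer_instance

lemma integral_stepKernel (M : FiniteMDP S A) (π : Policy S A) (f : S → A → ℝ) (x : S × A) :
    ∫ y, f y.1 y.2 ∂(stepKernel M π x) = nextVal M (avg π f) x.1 x.2 := by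
  unfold stepKernel
  rw [ProbabilityTheory.integral_compProd (f := fun y : S × A => f y.1 y.2) Integrable.of_finite]
  simp only [Kernel.prodMkLeft_apply]
  have : ∀ s, ∫ a, f s a ∂(policyKernel π s) = avg π f s := fun s =>
    integral_simplexMeasure (π s) (f s)
  simp only [this]
  exact integral_simplexMeasure _ _

lemma trajLaw_map_zero (M : FiniteMDP S A) (π : Policy S A) (s : S) :
    (trajLaw M π s).map (fun ω => ω 0) = Measure.dirac s ⊗ₘ policyKernel π := by
  unfold trajLaw Kernel.trajMeasure
  have h : (fun ω : ℕ → S × A => ω 0) =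
      (fun x : (Finset.Iic 0 → S × A) => x ⟨0, Finset.mem_Iic.2 le_rfl⟩) ∘
        Preorder.frestrictLe (π := fun _ => S × A) 0 := rfl
  rw [h, ← Measure.map_map (g := fun x : (Finset.Iic 0 → S × A) => x ⟨0, Finset.mem_Iic.2 le_rfl⟩)
      (f := Preorder.frestrictLe (π := fun _ => S × A) 0) (measurable_pi_apply _)
      (Preorder.measurable_frestrictLe 0),
    Measure.map_comp _ _ (Preorder.measurable_frestrictLe 0), Kernel.traj_map_frestrictLe,
    Kernel.partialTraj_self, Measure.id_comp, Measure.map_map (measurable_pi_apply _)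
      (MeasurableEquiv.measurable _)]
  exact Measure.map_id

lemma trajLaw_map_succ (M : FiniteMDP S A) (π : Policy S A) (s : S) (n : ℕ) :
    (trajLaw M π s).map (fun ω => ω (n + 1)) =
      stepKernel M π ∘ₘ (trajLaw M π s).map (fun ω => ω n) := by
  have h := Kernel.map_frestrictLe_trajMeasure_compProd_eq_map_trajMeasure
    (X := fun _ => S × A) (μ₀ := Measure.dirac s ⊗ₘ policyKernel π) (κ := historyKernel M π) (a := n)
  have h2 := congrArg Measure.snd h
  rw [Measure.snd_compProd, Measure.snd, Measure.map_map measurable_snd (by fun_prop)] at h2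
  refine h2.symm.trans ?_
  change historyKernel M π n ∘ₘ (trajLaw M π s).map _ = _
  rw [historyKernel, ← Kernel.comp_deterministic_eq_comap, ← Measure.comp_assoc,
    Measure.deterministic_comp_eq_map, Measure.map_map (measurable_pi_apply _) (by fun_prop)]
  rfl

lemma integral_trajLaw_apply (M : FiniteMDP S A) (π : Policy S A) (s : S) (n : ℕ)
    (f : S → A → ℝ) :
    ∫ ω, f (ω n).1 (ω n).2 ∂(trajLaw M π s) = ((stepOp M π)^[n] (avg π f)) s := by
  have key : ∀ n (f : S → A → ℝ), ∫ ω, f (ω n).1 (ω n).2 ∂(trajLaw M π s)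
      = ∫ x, f x.1 x.2 ∂((trajLaw M π s).map (fun ω => ω n)) := fun n f =>
    (integral_map (φ := fun ω : ℕ → S × A => ω n) (f := fun x : S × A => f x.1 x.2)
      (measurable_pi_apply n).aemeasurable (Measurable.of_discrete).aestronglyMeasurable).symm
  induction n generalizing f with
  | zero =>
    rw [key, trajLaw_map_zero, Measure.integral_compProd Integrable.of_finite, integral_dirac]
    exact integral_simplexMeasure _ _
  | succ n ih =>
    have : IsProbabilityMeasure ((trajLaw M π s).map (fun ω => ω n)) :=
      Measure.isProbabilityMeasure_map (measurable_pi_apply n).aemeasurable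
    rw [key, trajLaw_map_succ, ← Measure.snd_compProd, Measure.snd,
      integral_map (φ := Prod.snd) (f := fun x : S × A => f x.1 x.2) measurable_snd.aemeasurable
        (Measurable.of_discrete).aestronglyMeasurable,
      Measure.integral_compProd (f := fun p : (S × A) × (S × A) => f p.2.1 p.2.2)
        Integrable.of_finite]
    simp only [integral_stepKernel]
    rw [← key n (nextVal M (avg π f)), ih, Function.iterate_succ_apply]
    rfl

lemma value_eq_tsum (M : FiniteMDP S A) (τ : ℝ) (π : Policy S A) (s : S) :
    HasSum (fun t => M.γ ^ t * ((stepOp M π)^[t] (regReward M τ π)) s) (value M τ π s) := by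
  set f : S → A → ℝ := fun s a => M.r s a - τ * Real.log ((π s).1 a) with hf
  obtain ⟨C, hC⟩ : ∃ C : ℝ, ∀ x : S × A, |f x.1 x.2| ≤ C := by
    obtain ⟨C, hC⟩ := (Set.finite_range fun x : S × A => |f x.1 x.2|).bddAbove
    exact ⟨C, fun x => hC ⟨x, rfl⟩⟩
  have hm : ∀ t, Measurable fun ω : ℕ → S × A => M.γ ^ t * f (ω t).1 (ω t).2 := fun t => by
    have : Measurable fun x : S × A => f x.1 x.2 := Measurable.of_discrete
    exact (this.comp (measurable_pi_apply t)).const_mul _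
  have hb : ∀ t (ω : ℕ → S × A), ‖M.γ ^ t * f (ω t).1 (ω t).2‖ ≤ M.γ ^ t * C := fun t ω => by
    rw [norm_mul, Real.norm_of_nonneg (pow_nonneg M.γ_nonneg t), Real.norm_eq_abs]
    exact mul_le_mul_of_nonneg_left (hC _) (pow_nonneg M.γ_nonneg t)
  have hg : Summable fun t => M.γ ^ t * C :=
    (summable_geometric_of_lt_one M.γ_nonneg M.γ_lt_one).mul_right C
  have hi : ∀ t, Integrable (fun ω : ℕ → S × A => M.γ ^ t * f (ω t).1 (ω t).2) (trajLaw M π s) :=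
    fun t => Integrable.of_bound (hm t).aestronglyMeasurable (M.γ ^ t * C)
      (Filter.Eventually.of_forall (hb t))
  have := hasSum_integral_of_summable_integral_norm hi (by
    refine Summable.of_nonneg_of_le (fun t => integral_nonneg fun ω => norm_nonneg _) (fun t => ?_) hg
    calc ∫ ω, ‖M.γ ^ t * f (ω t).1 (ω t).2‖ ∂(trajLaw M π s)
        ≤ ∫ _, M.γ ^ t * C ∂(trajLaw M π s) :=
          integral_mono (hi t).norm (integrable_const _) (hb t)
      _ = M.γ ^ t * C := by simp)
  simp only [integral_const_mul, integral_trajLaw_apply] at this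
  exact this

/-- The Bellman equation. -/
lemma value_eq (M : FiniteMDP S A) (τ : ℝ) (π : Policy S A) (s : S) :
    value M τ π s = regReward M τ π s + M.γ * stepOp M π (value M τ π) s := by
  have h := value_eq_tsum M τ π
  have h1 := (stepOp_hasSum M π h s).mul_left M.γ
  have h2 := ((hasSum_nat_add_iff' 1).2 (h s))
  have h3 : (fun t => M.γ * stepOp M π (fun s => M.γ ^ t * ((stepOp M π)^[t] (regReward M τ π)) s) s)
      = fun t => M.γ ^ (t + 1) * ((stepOp M π)^[t + 1] (regReward M τ π)) s := by
    funext t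
    rw [stepOp_smul, Function.iterate_succ_apply', pow_succ]
    ring
  have h4 := (h3 ▸ h1).unique h2
  simp only [Finset.range_one, Finset.sum_singleton, pow_zero, one_mul, Function.iterate_zero,
    id] at h4
  linarith

end Bellman

section FiniteInequalities

variable {ι : Type*} [Fintype ι]

lemma nonempty_of_stdSimplex (q : stdSimplex ℝ ι) : Nonempty ι := by
  by_contra h
  rw [not_nonempty_iff] at h
  have := q.2.2
  simp at this

/-- Hoeffding's lemma on a finite type. -/
lemma sum_mul_exp_le (p : stdSimplex ℝ ι) (u : ι → ℝ) {m : ℝ} (hm : ∀ i, |u i| ≤ m) :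
    ∑ i, p.1 i * Real.exp (u i) ≤ Real.exp (∑ i, p.1 i * u i + m ^ 2 / 2) := by
  let _ : MeasurableSpace ι := ⊤
  have _ : DiscreteMeasurableSpace ι := ⟨fun _ => trivial⟩
  have h := (hasSubgaussianMGF_of_mem_Icc (μ := simplexMeasure p) (X := u) (a := -m) (b := m)
    (Measurable.of_discrete).aemeasurable
    (Filter.Eventually.of_forall fun i => abs_le.1 (hm i))).mgf_le 1
  simp only [mgf, integral_simplexMeasure, one_mul] at h
  have e : ((((‖m - -m‖₊ / 2) ^ 2 : NNReal) : ℝ)) * 1 ^ 2 / 2 = m ^ 2 / 2 := by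
    push_cast
    rw [div_pow, Real.norm_eq_abs, sq_abs]
    ring
  rw [e] at h
  simp only [Real.exp_sub, mul_div_assoc', ← Finset.sum_div] at h
  rw [Real.exp_add, mul_comm]
  exact (div_le_iff₀ (Real.exp_pos _)).1 h

/-- The Gibbs variational inequality. -/
lemma sum_mul_add_log_sub_le (q : stdSimplex ℝ ι) {p u : ι → ℝ} (hp : ∀ i, 0 < p i) :
    ∑ i, q.1 i * (u i + Real.log (p i) - Real.log (q.1 i))
      ≤ Real.log (∑ i, p i * Real.exp (u i)) := by
  set Z := ∑ i, p i * Real.exp (u i) with hZ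
  have hne : Nonempty ι := nonempty_of_stdSimplex q
  have hZ0 : 0 < Z := Finset.sum_pos (fun i _ => mul_pos (hp i) (Real.exp_pos _)) Finset.univ_nonempty
  have key : ∀ i, q.1 i * (u i + Real.log (p i) - Real.log (q.1 i))
      ≤ q.1 i * Real.log Z + (p i * Real.exp (u i) / Z - q.1 i) := by
    intro i
    have hy : 0 < p i * Real.exp (u i) / Z := div_pos (mul_pos (hp i) (Real.exp_pos _)) hZ0
    rcases (q.2.1 i).eq_or_lt with h | h
    · rw [← h]; simpa using hy.le
    · have h1 := Real.log_le_sub_one_of_pos (div_pos hy h)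
      rw [Real.log_div hy.ne' h.ne', Real.log_div (mul_pos (hp i) (Real.exp_pos _)).ne' hZ0.ne',
        Real.log_mul (hp i).ne' (Real.exp_pos _).ne', Real.log_exp] at h1
      have h2 := mul_le_mul_of_nonneg_left h1 h.le
      have h3 : q.1 i * (p i * Real.exp (u i) / Z / q.1 i - 1) = p i * Real.exp (u i) / Z - q.1 i := by
        field_simp
      rw [h3] at h2
      linarith
  calc _ ≤ ∑ i, (q.1 i * Real.log Z + (p i * Real.exp (u i) / Z - q.1 i)) :=
        Finset.sum_le_sum fun i _ => key i
    _ = Real.log Z := by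
        rw [Finset.sum_add_distrib, Finset.sum_sub_distrib, ← Finset.sum_mul, ← Finset.sum_div, q.2.2,
          ← hZ, div_self hZ0.ne']
        ring

lemma neg_sum_mul_log_le [Nonempty ι] (q : stdSimplex ℝ ι) :
    -∑ i, q.1 i * Real.log (q.1 i) ≤ Real.log (Fintype.card ι) := by
  have h := sum_mul_add_log_sub_le q (p := fun _ => 1) (u := fun _ => 0) (fun _ => one_pos)
  simpa using h

lemma sum_mul_sub_log_le {τ : ℝ} (hτ : 0 < τ) (p q : stdSimplex ℝ ι) (hp : ∀ i, 0 < p.1 i)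
    {f : ι → ℝ} (hf : ∑ i, p.1 i * f i = 0) {m : ℝ} (hm : ∀ i, |f i| ≤ m) :
    ∑ i, q.1 i * (f i + τ * Real.log (p.1 i) - τ * Real.log (q.1 i)) ≤ m ^ 2 / (2 * τ) := by
  have h1 := sum_mul_add_log_sub_le q (p := p.1) (u := fun i => f i / τ) hp
  have h2 := sum_mul_exp_le p (fun i => f i / τ) (m := m / τ) (fun i => by
    rw [abs_div, abs_of_pos hτ]
    exact div_le_div_of_nonneg_right (hm i) hτ.le)
  have h0 : ∑ i, p.1 i * (f i / τ) = 0 := by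
    simp only [mul_div_assoc', ← Finset.sum_div, hf, zero_div]
  have hne : Nonempty ι := nonempty_of_stdSimplex q
  rw [h0, zero_add] at h2
  have h3 := Real.log_le_log
    (Finset.sum_pos (fun i _ => mul_pos (hp i) (Real.exp_pos _)) Finset.univ_nonempty) h2
  rw [Real.log_exp] at h3
  have h4 := mul_le_mul_of_nonneg_left (h1.trans h3) hτ.le
  rw [Finset.mul_sum] at h4
  calc _ = _ := Finset.sum_congr rfl fun i _ => by field_simp
    _ ≤ _ := h4
    _ = _ := by field_simp

lemma mul_exp_sub_one_ge {h b m : ℝ} (hh : 0 ≤ h) (hm : |h * b| ≤ m) :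
    h * b ^ 2 * Real.exp (-m) ≤ b * (Real.exp (h * b) - 1) := by
  have hm0 : 0 ≤ m := (abs_nonneg _).trans hm
  rcases le_total 0 b with hb | hb
  · have h1 := Real.add_one_le_exp (h * b)
    have h2 : Real.exp (-m) ≤ 1 := Real.exp_le_one_iff.2 (by linarith)
    calc h * b ^ 2 * Real.exp (-m) ≤ h * b ^ 2 * 1 := by gcongr
      _ = b * (h * b) := by ring
      _ ≤ _ := by gcongr; linarith
  · have h1 := Real.add_one_le_exp (-(h * b))
    have h2 : Real.exp (-m) ≤ Real.exp (h * b) := Real.exp_le_exp.2 (by linarith [(abs_le.1 hm).1])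
    have h3 : Real.exp (h * b) * Real.exp (-(h * b)) = 1 := by rw [← Real.exp_add]; simp
    have h4 : (-(h * b)) * Real.exp (h * b) ≤ 1 - Real.exp (h * b) := by
      nlinarith [Real.exp_pos (h * b)]
    calc h * b ^ 2 * Real.exp (-m) ≤ h * b ^ 2 * Real.exp (h * b) := by gcongr
      _ = (-b) * ((-(h * b)) * Real.exp (h * b)) := by ring
      _ ≤ (-b) * (1 - Real.exp (h * b)) := mul_le_mul_of_nonneg_left h4 (by linarith)
      _ = _ := by ring

/-- The improvement of the linear part under an exponential reweighting by `h * b`. -/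
lemma le_sum_reweight (p q : stdSimplex ℝ ι) (hp : ∀ i, 0 < p.1 i)
    {f : ι → ℝ} (hf : ∑ i, p.1 i * f i = 0) {h m : ℝ} (hh : 0 ≤ h)
    (hm : ∀ i, |h * (p.1 i * f i)| ≤ m)
    (hq : ∀ i, q.1 i = p.1 i * Real.exp (h * (p.1 i * f i)) /
      ∑ j, p.1 j * Real.exp (h * (p.1 j * f j))) :
    h * Real.exp (-(2 * m)) * ∑ i, (p.1 i * f i) ^ 2 ≤ ∑ i, q.1 i * f i := by
  set Z := ∑ j, p.1 j * Real.exp (h * (p.1 j * f j)) with hZ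
  have hne : Nonempty ι := nonempty_of_stdSimplex q
  have hZ0 : 0 < Z := Finset.sum_pos (fun i _ => mul_pos (hp i) (Real.exp_pos _)) Finset.univ_nonempty
  have hZm : Z ≤ Real.exp m := by
    calc Z ≤ ∑ i, p.1 i * Real.exp m := Finset.sum_le_sum fun i _ =>
          mul_le_mul_of_nonneg_left (Real.exp_le_exp.2 (abs_le.1 (hm i)).2) (hp i).le
      _ = Real.exp m := by rw [← Finset.sum_mul, p.2.2, one_mul]
  have e1 : ∑ i, q.1 i * f i = (∑ i, p.1 i * f i * (Real.exp (h * (p.1 i * f i)) - 1)) / Z := by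
    simp only [mul_sub, mul_one, Finset.sum_sub_distrib, hf, sub_zero, Finset.sum_div]
    exact Finset.sum_congr rfl fun i _ => by rw [hq]; ring
  rw [e1, le_div_iff₀ hZ0]
  have h0 : 0 ≤ h * ∑ i, (p.1 i * f i) ^ 2 := mul_nonneg hh (Finset.sum_nonneg fun i _ => sq_nonneg _)
  calc h * Real.exp (-(2 * m)) * (∑ i, (p.1 i * f i) ^ 2) * Z
      = h * (∑ i, (p.1 i * f i) ^ 2) * Real.exp (-(2 * m)) * Z := by ring
    _ ≤ h * (∑ i, (p.1 i * f i) ^ 2) * Real.exp (-(2 * m)) * Real.exp m := by gcongr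
    _ = ∑ i, h * (p.1 i * f i) ^ 2 * Real.exp (-m) := by
        rw [mul_assoc, ← Real.exp_add, Finset.mul_sum, Finset.sum_mul]
        congr! 3
        ring
    _ ≤ _ := Finset.sum_le_sum fun i _ => mul_exp_sub_one_ge hh (hm i)

/-- The relative entropy of an exponential reweighting is quadratic in the exponent. -/
lemma sum_reweight_log_le (p q : stdSimplex ℝ ι) (hp : ∀ i, 0 < p.1 i) (u : ι → ℝ)
    (hq : ∀ i, q.1 i = p.1 i * Real.exp (u i) / ∑ j, p.1 j * Real.exp (u j)) :
    ∑ i, q.1 i * (Real.log (q.1 i) - Real.log (p.1 i)) ≤ (∑ i, u i ^ 2) / 2 := by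
  set Z := ∑ j, p.1 j * Real.exp (u j) with hZ
  have hne : Nonempty ι := nonempty_of_stdSimplex q
  have hZ0 : 0 < Z := Finset.sum_pos (fun i _ => mul_pos (hp i) (Real.exp_pos _)) Finset.univ_nonempty
  have hlog : ∀ i, Real.log (q.1 i) - Real.log (p.1 i) = u i - Real.log Z := fun i => by
    rw [hq, Real.log_div (mul_pos (hp i) (Real.exp_pos _)).ne' hZ0.ne',
      Real.log_mul (hp i).ne' (Real.exp_pos _).ne', Real.log_exp]
    ring
  have hsq : 0 ≤ ∑ i, u i ^ 2 := Finset.sum_nonneg fun i _ => sq_nonneg _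
  have h1 := sum_mul_exp_le q (fun i => - u i) (m := Real.sqrt (∑ i, u i ^ 2)) (fun i => by
    rw [abs_neg]
    exact Real.abs_le_sqrt (Finset.single_le_sum (f := fun i => u i ^ 2)
      (fun i _ => sq_nonneg _) (Finset.mem_univ i)))
  rw [Real.sq_sqrt hsq] at h1
  have h2 : ∑ i, q.1 i * Real.exp (-u i) = 1 / Z := by
    rw [← p.2.2, Finset.sum_div]
    refine Finset.sum_congr rfl fun i _ => ?_
    rw [hq, Real.exp_neg]
    field_simp [(Real.exp_pos (u i)).ne']
  rw [h2] at h1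
  have h3 := Real.log_le_log (by positivity) h1
  rw [Real.log_exp, one_div, Real.log_inv] at h3
  simp only [hlog, mul_sub, Finset.sum_sub_distrib, ← Finset.sum_mul, q.2.2]
  simp only [mul_neg, Finset.sum_neg_distrib] at h3
  linarith

lemma le_sum_reweight_sub_log {τ : ℝ} (hτ : 0 < τ) (p q : stdSimplex ℝ ι) (hp : ∀ i, 0 < p.1 i)
    {f : ι → ℝ} (hf : ∑ i, p.1 i * f i = 0) {h m : ℝ} (hh : 0 ≤ h)
    (hm : ∀ i, |h * (p.1 i * f i)| ≤ m)
    (hq : ∀ i, q.1 i = p.1 i * Real.exp (h * (p.1 i * f i)) /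
      ∑ j, p.1 j * Real.exp (h * (p.1 j * f j))) :
    h / 2 * (2 * Real.exp (-(2 * m)) - τ * h) * ∑ i, (p.1 i * f i) ^ 2
      ≤ ∑ i, q.1 i * (f i + τ * Real.log (p.1 i) - τ * Real.log (q.1 i)) := by
  have h1 := le_sum_reweight p q hp hf hh hm hq
  have h2 := mul_le_mul_of_nonneg_left
    (sum_reweight_log_le p q hp (fun i => h * (p.1 i * f i)) hq) hτ.le
  have e : ∑ i, q.1 i * (f i + τ * Real.log (p.1 i) - τ * Real.log (q.1 i)) =
      ∑ i, q.1 i * f i - τ * ∑ i, q.1 i * (Real.log (q.1 i) - Real.log (p.1 i)) := by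
    rw [Finset.mul_sum, ← Finset.sum_sub_distrib]
    exact Finset.sum_congr rfl fun i _ => by ring
  simp only [mul_pow] at h2
  rw [← Finset.mul_sum] at h2
  simp only [← mul_pow] at h2
  rw [e]
  linarith

/-- If the coordinates of a sequence of logits have conserved sum, drop by at most `m` per step and
do not drop while their softmax weight is below `ε`, then the softmax weights are bounded away
from zero. -/
lemma exists_pos_le_softmax_weight [Nonempty ι] {x : ℕ → ι → ℝ} {m ε : ℝ} (hε : 0 < ε)
    (hsum : ∀ k, ∑ i, x (k + 1) i = ∑ i, x k i) (hdrop : ∀ k i, x k i - m ≤ x (k + 1) i)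
    (hup : ∀ k i, Real.exp (x k i) / ∑ j, Real.exp (x k j) < ε → x k i ≤ x (k + 1) i) :
    ∃ δ > 0, ∀ k i, δ ≤ Real.exp (x k i) / ∑ j, Real.exp (x k j) := by
  set n : ℝ := (Fintype.card ι : ℝ) with hn
  have hn0 : 0 < n := Nat.cast_pos.2 Fintype.card_pos
  have hZ : ∀ k, 0 < ∑ j, Real.exp (x k j) := fun k =>
    Finset.sum_pos (fun _ _ => Real.exp_pos _) Finset.univ_nonempty
  have hsum' : ∀ k, ∑ i, x k i = ∑ i, x 0 i := fun k => by
    induction k with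
    | zero => rfl
    | succ k ih => rw [hsum, ih]
  set T := ∑ i, x 0 i
  obtain ⟨i₀, hi₀⟩ := Finite.exists_min (x 0)
  set l := min (x 0 i₀) (Real.log ε + T / n - m) with hl
  have hlow : ∀ k i, l ≤ x k i := fun k => by
    induction k with
    | zero => exact fun i => (min_le_left _ _).trans (hi₀ i)
    | succ k ih =>
      intro i
      rcases lt_or_ge (Real.exp (x k i) / ∑ j, Real.exp (x k j)) ε with h | h
      · exact (ih i).trans (hup k i h)
      · have h1 := Real.log_le_log hε h
        rw [Real.log_div (Real.exp_pos _).ne' (hZ k).ne', Real.log_exp] at h1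
        have h2 : T ≤ n * Real.log (∑ j, Real.exp (x k j)) := by
          rw [← hsum' k, hn, ← nsmul_eq_mul]
          refine Finset.sum_le_card_nsmul _ _ _ fun j _ => ?_
          rw [Real.le_log_iff_exp_le (hZ k)]
          exact Finset.single_le_sum (f := fun j => Real.exp (x k j))
            (fun _ _ => (Real.exp_pos _).le) (Finset.mem_univ j)
        have h3 : T / n ≤ Real.log (∑ j, Real.exp (x k j)) := by
          rw [div_le_iff₀ hn0]; linarith
        have h4 := min_le_right (x 0 i₀) (Real.log ε + T / n - m)
        linarith [hdrop k i]
  have hhigh : ∀ k i, x k i ≤ T - n * l + l := fun k i => by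
    have h := Finset.single_le_sum (f := fun i => x k i - l)
      (fun i _ => sub_nonneg.2 (hlow k i)) (Finset.mem_univ i)
    simp only [Finset.sum_sub_distrib, hsum', Finset.sum_const, Finset.card_univ,
      nsmul_eq_mul, ← hn] at h
    linarith
  refine ⟨Real.exp l / (n * Real.exp (T - n * l + l)), by positivity, fun k i => ?_⟩
  refine div_le_div₀ (Real.exp_pos _).le (Real.exp_le_exp.2 (hlow k i)) (hZ k) ?_
  rw [hn, ← nsmul_eq_mul]
  exact Finset.sum_le_card_nsmul _ _ _ fun j _ => Real.exp_le_exp.2 (hhigh k j)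

end FiniteInequalities

section StepSize

lemma existsUnique_exp_neg_eq {c d : ℝ} (hc : 0 < c) (hd : 0 < d) :
    ∃ β : ℝ, (∀ x : ℝ, Real.exp (-(c * x)) = d * x ↔ x = β) ∧
      ∀ x : ℝ, d * x < Real.exp (-(c * x)) ↔ x < β := by
  have hanti : StrictAnti fun x : ℝ => Real.exp (-(c * x)) - d * x := fun x y hxy => by
    have h1 : Real.exp (-(c * y)) < Real.exp (-(c * x)) := Real.exp_lt_exp.2 (by nlinarith)
    have h2 : d * x < d * y := by nlinarith
    dsimp only
    linarith
  have hcont : Continuous fun x : ℝ => Real.exp (-(c * x)) - d * x := by fun_prop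
  obtain ⟨β, -, hβ⟩ := intermediate_value_Icc' (a := 0) (b := 1 / d) (by positivity)
    hcont.continuousOn (show (0 : ℝ) ∈ _ from ⟨by
      have : Real.exp (-(c * (1 / d))) ≤ 1 := Real.exp_le_one_iff.2 (by
        have : 0 < c * (1 / d) := by positivity
        linarith)
      rw [mul_one_div_cancel hd.ne']
      linarith, by simp⟩)
  dsimp only at hβ
  refine ⟨β, fun x => ⟨fun h => hanti.injective (by linarith), fun h => ?_⟩,
    fun x => ?_⟩
  · subst h; linarith
  · have h := hanti.lt_iff_gt (a := β) (b := x)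
    rw [← h, hβ, sub_pos]

lemma two_mul_step_lt {τ γ l : ℝ} (hτ : 0 < τ) (h0 : 0 ≤ γ) (h1 : γ < 1) (hl : 0 ≤ l) :
    τ / (2 * (1 - γ)) * (2 * ((1 - γ) ^ 3 / (8 + τ * (4 + 8 * l)))) <
      Real.exp (-(2 * (1 + τ * l) / (1 - γ) ^ 2 * (2 * ((1 - γ) ^ 3 / (8 + τ * (4 + 8 * l)))))) := by
  have hg : 0 < 1 - γ := by linarith
  have hD : 0 < 8 + τ * (4 + 8 * l) := by positivity
  have e1 : τ / (2 * (1 - γ)) * (2 * ((1 - γ) ^ 3 / (8 + τ * (4 + 8 * l))))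
      = τ * (1 - γ) ^ 2 / (8 + τ * (4 + 8 * l)) := by field_simp
  have e2 : 2 * (1 + τ * l) / (1 - γ) ^ 2 * (2 * ((1 - γ) ^ 3 / (8 + τ * (4 + 8 * l))))
      = 4 * (1 + τ * l) * (1 - γ) / (8 + τ * (4 + 8 * l)) := by field_simp; ring
  rw [e1, e2]
  refine lt_of_lt_of_le ?_ (Real.one_sub_le_exp_neg _)
  rw [lt_sub_iff_add_lt, ← add_div, div_lt_one hD]
  have hl' : 0 ≤ τ * l := by positivity
  have h2 : (1 - γ) ^ 2 ≤ 1 := pow_le_one₀ hg.le (by linarith)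
  have h3 : 4 * (1 + τ * l) * (1 - γ) ≤ 4 * (1 + τ * l) := by nlinarith
  nlinarith [mul_le_mul_of_nonneg_left h2 hτ.le]

lemma step_mul_lt_one {τ η g e : ℝ} (hg : 0 < g) (hg1 : g ≤ 1) (he : 0 < e) (he1 : e < 1) :
    η * τ * (2 * e - τ * η / g) < 1 := by
  have h1 : η * τ * (2 * e - τ * η / g) = g * e ^ 2 - (τ * η - g * e) ^ 2 / g := by
    field_simp
    ring
  have h2 : 0 ≤ (τ * η - g * e) ^ 2 / g := by positivity
  have h3 : g * e ^ 2 < 1 := by nlinarith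
  linarith

end StepSize

section Operators

variable {S A : Type*} [Fintype S] [Fintype A]

lemma sum_mul_le_of_le {ι : Type*} [Fintype ι] (p : stdSimplex ℝ ι) {f : ι → ℝ} {c : ℝ}
    (h : ∀ i, f i ≤ c) : ∑ i, p.1 i * f i ≤ c := by
  calc ∑ i, p.1 i * f i ≤ ∑ i, p.1 i * c :=
        Finset.sum_le_sum fun i _ => mul_le_mul_of_nonneg_left (h i) (p.2.1 i)
    _ = c := by rw [← Finset.sum_mul, p.2.2, one_mul]

lemma stepOp_le (M : FiniteMDP S A) (π : Policy S A) {v : S → ℝ} {c : ℝ} (h : ∀ s, v s ≤ c)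
    (s : S) : stepOp M π v s ≤ c :=
  sum_mul_le_of_le _ fun _ => sum_mul_le_of_le _ h

lemma stepOp_sub (M : FiniteMDP S A) (π : Policy S A) (v w : S → ℝ) (s : S) :
    stepOp M π (fun s => v s - w s) s = stepOp M π v s - stepOp M π w s := by
  simp only [stepOp, avg, nextVal, mul_sub, Finset.sum_sub_distrib]

lemma nextVal_nonneg (M : FiniteMDP S A) {v : S → ℝ} (h : ∀ s, 0 ≤ v s) (s : S) (a : A) :
    0 ≤ nextVal M v s a :=
  Finset.sum_nonneg fun s' _ => mul_nonneg ((M.P s a).2.1 s') (h s')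

lemma stepOp_nonneg (M : FiniteMDP S A) (π : Policy S A) {v : S → ℝ} (h : ∀ s, 0 ≤ v s)
    (s : S) : 0 ≤ stepOp M π v s :=
  Finset.sum_nonneg fun a _ => mul_nonneg ((π s).2.1 a) (nextVal_nonneg M h s a)

lemma le_div_of_le_add_stepOp (M : FiniteMDP S A) (π : Policy S A) {x : S → ℝ} {c : ℝ}
    (h : ∀ s, x s ≤ c + M.γ * stepOp M π x s) (s : S) : x s ≤ c / (1 - M.γ) := by
  have : Nonempty S := ⟨s⟩
  obtain ⟨s₀, hs₀⟩ := Finite.exists_max x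
  refine (hs₀ s).trans ?_
  rw [le_div_iff₀ (by linarith [M.γ_lt_one])]
  have := mul_le_mul_of_nonneg_left (stepOp_le M π hs₀ s₀) M.γ_nonneg
  linarith [h s₀]

lemma nonneg_of_stepOp_le (M : FiniteMDP S A) (π : Policy S A) {x : S → ℝ}
    (h : ∀ s, M.γ * stepOp M π x s ≤ x s) (s : S) : 0 ≤ x s := by
  have h1 := le_div_of_le_add_stepOp M π (x := fun s => -1 * x s) (c := 0) (fun s => by
    rw [stepOp_smul]
    linarith [h s]) s
  rw [zero_div] at h1
  linarith

lemma le_of_eq_add_stepOp (M : FiniteMDP S A) (π : Policy S A) {x b : S → ℝ}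
    (h : ∀ s, x s = b s + M.γ * stepOp M π x s) (hb : ∀ s, 0 ≤ b s) (s : S) : b s ≤ x s := by
  have h0 := nonneg_of_stepOp_le M π (x := x) fun s => by linarith [h s, hb s]
  linarith [h s, mul_nonneg M.γ_nonneg (stepOp_nonneg M π h0 s)]

lemma stdSimplex_le_one {ι : Type*} [Fintype ι] (p : stdSimplex ℝ ι) (i : ι) : p.1 i ≤ 1 :=
  (Finset.single_le_sum (fun j _ => p.2.1 j) (Finset.mem_univ i)).trans_eq p.2.2

lemma mul_log_nonpos {τ : ℝ} (hτ : 0 < τ) {ι : Type*} [Fintype ι] (p : stdSimplex ℝ ι) (a : ι) :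
    τ * Real.log (p.1 a) ≤ 0 :=
  mul_nonpos_of_nonneg_of_nonpos hτ.le (Real.log_nonpos (p.2.1 a) (stdSimplex_le_one p a))

lemma regReward_nonneg (M : FiniteMDP S A) {τ : ℝ} (hτ : 0 < τ) (π : Policy S A) (s : S) :
    0 ≤ regReward M τ π s :=
  Finset.sum_nonneg fun a _ => mul_nonneg ((π s).2.1 a) (by
    linarith [(M.r_mem s a).1, mul_log_nonpos hτ (π s) a])

lemma regReward_le [Nonempty A] (M : FiniteMDP S A) {τ : ℝ} (hτ : 0 < τ) (π : Policy S A) (s : S) :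
    regReward M τ π s ≤ 1 + τ * Real.log (Fintype.card A) := by
  have h1 := sum_mul_le_of_le (π s) fun a => (M.r_mem s a).2
  have h2 := mul_le_mul_of_nonneg_left (neg_sum_mul_log_le (π s)) hτ.le
  have e : regReward M τ π s = ∑ a, (π s).1 a * M.r s a +
      τ * -∑ a, (π s).1 a * Real.log ((π s).1 a) := by
    rw [mul_neg, ← sub_eq_add_neg, Finset.mul_sum, ← Finset.sum_sub_distrib]
    exact Finset.sum_congr rfl fun a _ => by ring
  linarith

end Operators

section Advantage

variable {S A : Type*} [Fintype S] [MeasurableSpace S] [DiscreteMeasurableSpace S]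
  [Fintype A] [MeasurableSpace A] [DiscreteMeasurableSpace A]

/-- The entropy regularized advantage function. -/
def adv (M : FiniteMDP S A) (τ : ℝ) (π : Policy S A) (s : S) (a : A) : ℝ :=
  M.r s a + M.γ * nextVal M (value M τ π) s a - τ * Real.log ((π s).1 a) - value M τ π s

/-- The residual of `V_τ^π` in the Bellman equation of `π'`. -/
def resid (M : FiniteMDP S A) (τ : ℝ) (π π' : Policy S A) (s : S) : ℝ :=
  ∑ a, (π' s).1 a * (adv M τ π s a + τ * Real.log ((π s).1 a) - τ * Real.log ((π' s).1 a))

lemma resid_eq (M : FiniteMDP S A) (τ : ℝ) (π π' : Policy S A) (s : S) :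
    resid M τ π π' s =
      regReward M τ π' s + M.γ * stepOp M π' (value M τ π) s - value M τ π s := by
  have h : value M τ π s = ∑ a, (π' s).1 a * value M τ π s := by
    rw [← Finset.sum_mul, (π' s).2.2, one_mul]
  rw [h]
  simp only [resid, adv, regReward, stepOp, avg]
  rw [Finset.mul_sum, ← Finset.sum_add_distrib, ← Finset.sum_sub_distrib]
  exact Finset.sum_congr rfl fun a _ => by ring

lemma resid_self (M : FiniteMDP S A) (τ : ℝ) (π : Policy S A) (s : S) : resid M τ π π s = 0 := by
  rw [resid_eq, ← value_eq, sub_self]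

lemma sum_mul_adv (M : FiniteMDP S A) (τ : ℝ) (π : Policy S A) (s : S) :
    ∑ a, (π s).1 a * adv M τ π s a = 0 := by
  simpa [resid] using resid_self M τ π s

lemma resid_le (M : FiniteMDP S A) {τ κ : ℝ} (hτ : 0 < τ) (hκ : 0 < κ) (π π' : Policy S A)
    (s : S) (h : ∀ a, κ ≤ (π s).1 a) :
    resid M τ π π' s ≤ (∑ a, ((π s).1 a * adv M τ π s a) ^ 2) / (2 * τ * κ ^ 2) := by
  have h0 : 0 ≤ ∑ a, ((π s).1 a * adv M τ π s a) ^ 2 := Finset.sum_nonneg fun a _ => sq_nonneg _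
  have h1 := sum_mul_sub_log_le hτ (π s) (π' s) (fun a => hκ.trans_le (h a)) (sum_mul_adv M τ π s)
    (m := Real.sqrt (∑ a, ((π s).1 a * adv M τ π s a) ^ 2) / κ) (fun a => by
      rw [le_div_iff₀ hκ]
      calc |adv M τ π s a| * κ ≤ |adv M τ π s a| * (π s).1 a :=
            mul_le_mul_of_nonneg_left (h a) (abs_nonneg _)
        _ = |(π s).1 a * adv M τ π s a| := by
            rw [abs_mul, abs_of_nonneg ((π s).2.1 a), mul_comm]
        _ ≤ _ := Real.abs_le_sqrt (Finset.single_le_sum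
            (f := fun a => ((π s).1 a * adv M τ π s a) ^ 2)
            (fun a _ => sq_nonneg _) (Finset.mem_univ a)))
  rw [div_pow, Real.sq_sqrt h0, div_div] at h1
  refine h1.trans_eq ?_
  congr 1
  ring

lemma value_sub_value (M : FiniteMDP S A) (τ : ℝ) (π π' : Policy S A) (s : S) :
    value M τ π' s - value M τ π s = resid M τ π π' s +
      M.γ * stepOp M π' (fun s => value M τ π' s - value M τ π s) s := by
  rw [stepOp_sub, resid_eq, value_eq M τ π' s]
  ring

lemma value_nonneg (M : FiniteMDP S A) {τ : ℝ} (hτ : 0 < τ) (π : Policy S A) (s : S) :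
    0 ≤ value M τ π s :=
  (regReward_nonneg M hτ π s).trans
    (le_of_eq_add_stepOp M π (value_eq M τ π) (regReward_nonneg M hτ π) s)

lemma qValue_nonneg (M : FiniteMDP S A) {τ : ℝ} (hτ : 0 < τ) (π : Policy S A) (s : S) (a : A) :
    0 ≤ M.r s a + M.γ * nextVal M (value M τ π) s a :=
  add_nonneg (M.r_mem s a).1 (mul_nonneg M.γ_nonneg (nextVal_nonneg M (value_nonneg M hτ π) s a))

variable [Nonempty A]

lemma value_le (M : FiniteMDP S A) {τ : ℝ} (hτ : 0 < τ) (π : Policy S A) (s : S) :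
    value M τ π s ≤ (1 + τ * Real.log (Fintype.card A)) / (1 - M.γ) :=
  le_div_of_le_add_stepOp M π (fun s => by
    rw [value_eq M τ π s]
    linarith [regReward_le M hτ π s]) s

lemma abs_mul_adv_le (M : FiniteMDP S A) {τ : ℝ} (hτ : 0 < τ) (π : Policy S A) (s : S) (a : A) :
    |(π s).1 a * adv M τ π s a| ≤ (1 + τ * Real.log (Fintype.card A)) / (1 - M.γ) := by
  have hV := value_nonneg M hτ π s
  have hV' := value_le M hτ π s
  have h0 : ∀ b, 0 ≤ (π s).1 b * (adv M τ π s b + value M τ π s) := fun b => by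
    refine mul_nonneg ((π s).2.1 b) ?_
    unfold adv
    linarith [qValue_nonneg M hτ π s b, mul_log_nonpos hτ (π s) b]
  have h1 := Finset.single_le_sum (fun b _ => h0 b) (Finset.mem_univ a)
  have h2 : ∑ b, (π s).1 b * (adv M τ π s b + value M τ π s) = value M τ π s := by
    simp only [mul_add, Finset.sum_add_distrib, sum_mul_adv, ← Finset.sum_mul, (π s).2.2]
    ring
  rw [h2] at h1
  have h3 := h0 a
  have h4 : (π s).1 a * value M τ π s ≤ value M τ π s := by
    nlinarith [stdSimplex_le_one (π s) a]
  have h5 := mul_nonneg ((π s).2.1 a) hV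
  rw [abs_le]
  constructor <;> nlinarith

lemma adv_nonneg_of_lt (M : FiniteMDP S A) {τ : ℝ} (hτ : 0 < τ) (π : Policy S A) (s : S) (a : A)
    (hp : 0 < (π s).1 a)
    (h : (π s).1 a < Real.exp (-((1 + τ * Real.log (Fintype.card A)) / (1 - M.γ)) / τ)) :
    0 ≤ adv M τ π s a := by
  have h1 := Real.log_le_log hp h.le
  rw [Real.log_exp, le_div_iff₀ hτ] at h1
  unfold adv
  linarith [qValue_nonneg M hτ π s a, value_le M hτ π s]

lemma value_le_optValue (M : FiniteMDP S A) {τ : ℝ} (hτ : 0 < τ) (π : Policy S A) (s : S) :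
    value M τ π s ≤ optValue M τ s :=
  le_ciSup (f := fun π => value M τ π s)
    ⟨_, by rintro _ ⟨π, rfl⟩; exact value_le M hτ π s⟩ π

end Advantage

section Occupancy

variable {S A : Type*} [Fintype S] [DecidableEq S] [Fintype A]

/-- The matrix `I - γ P_π`. -/
def bellmanMatrix (M : FiniteMDP S A) (π : Policy S A) : Matrix S S ℝ :=
  1 - M.γ • Matrix.of fun s s' => ∑ a, (π s).1 a * (M.P s a).1 s'

lemma bellmanMatrix_mulVec (M : FiniteMDP S A) (π : Policy S A) (v : S → ℝ) (s : S) :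
    (bellmanMatrix M π).mulVec v s = v s - M.γ * stepOp M π v s := by
  rw [bellmanMatrix, Matrix.sub_mulVec, Matrix.one_mulVec, Matrix.smul_mulVec]
  simp only [Pi.sub_apply, Pi.smul_apply, smul_eq_mul, Matrix.mulVec, dotProduct, Matrix.of_apply,
    stepOp, avg, nextVal, Finset.sum_mul, Finset.mul_sum]
  rw [Finset.sum_comm]
  simp only [mul_assoc]

lemma isUnit_det_bellmanMatrix (M : FiniteMDP S A) (π : Policy S A) :
    IsUnit (bellmanMatrix M π).det := by
  rw [isUnit_iff_ne_zero]
  intro h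
  obtain ⟨v, hv, h0⟩ := Matrix.exists_mulVec_eq_zero_iff.2 h
  refine hv (funext fun s => le_antisymm ?_ ?_)
  · have := le_div_of_le_add_stepOp M π (x := v) (c := 0) (fun s => by
      have := congrFun h0 s
      rw [bellmanMatrix_mulVec] at this
      simp only [Pi.zero_apply] at this
      linarith) s
    simpa using this
  · exact nonneg_of_stepOp_le M π (fun s => by
      have := congrFun h0 s
      rw [bellmanMatrix_mulVec] at this
      simp only [Pi.zero_apply] at this
      linarith) s

/-- The unnormalized discounted state occupancy `∑ₜ γᵗ ℙ(s_t = s | s_0 ∼ μ, π)`. -/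
def occ (M : FiniteMDP S A) (μ : stdSimplex ℝ S) (π : Policy S A) : S → ℝ :=
  Matrix.vecMul μ.1 (bellmanMatrix M π)⁻¹

lemma sum_occ_mul (M : FiniteMDP S A) (μ : stdSimplex ℝ S) (π : Policy S A) {x b : S → ℝ}
    (h : ∀ s, x s = b s + M.γ * stepOp M π x s) :
    ∑ s, occ M μ π s * b s = ∑ s, μ.1 s * x s := by
  have hb : (bellmanMatrix M π).mulVec x = b := funext fun s => by
    rw [bellmanMatrix_mulVec]; linarith [h s]
  change occ M μ π ⬝ᵥ b = μ.1 ⬝ᵥ x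
  rw [occ, ← Matrix.dotProduct_mulVec, ← hb, Matrix.mulVec_mulVec,
    Matrix.nonsing_inv_mul _ (isUnit_det_bellmanMatrix M π), Matrix.one_mulVec]

lemma occ_bounds (M : FiniteMDP S A) (μ : stdSimplex ℝ S) (π : Policy S A) (s : S) :
    μ.1 s ≤ occ M μ π s ∧ occ M μ π s ≤ 1 / (1 - M.γ) := by
  set b : S → ℝ := Pi.single s 1 with hb
  set x : S → ℝ := (bellmanMatrix M π)⁻¹.mulVec b with hx
  have hN : (bellmanMatrix M π).mulVec x = b := by
    rw [hx, Matrix.mulVec_mulVec, Matrix.mul_nonsing_inv _ (isUnit_det_bellmanMatrix M π),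
      Matrix.one_mulVec]
  have h : ∀ s, x s = b s + M.γ * stepOp M π x s := fun s => by
    rw [← hN, bellmanMatrix_mulVec]; ring
  have h1 := sum_occ_mul M μ π h
  have hocc : occ M μ π s = ∑ s, μ.1 s * x s := by
    rw [← h1, hb]
    simp [Pi.single_apply]
  have hb0 : ∀ s, 0 ≤ b s := fun t => by
    rw [hb, Pi.single_apply]; split_ifs <;> norm_num
  have hb1 : ∀ s, b s ≤ 1 := fun t => by
    rw [hb, Pi.single_apply]; split_ifs <;> norm_num
  have hle := le_of_eq_add_stepOp M π h hb0
  have hx0 : ∀ s, 0 ≤ x s := fun s => (hb0 s).trans (hle s)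
  rw [hocc]
  constructor
  · calc μ.1 s ≤ μ.1 s * x s := by
          have : b s = 1 := by simp [hb]
          nlinarith [hle s, μ.2.1 s]
      _ ≤ _ := Finset.single_le_sum (f := fun s => μ.1 s * x s)
          (fun t _ => mul_nonneg (μ.2.1 t) (hx0 t)) (Finset.mem_univ s)
  · exact sum_mul_le_of_le μ (le_div_of_le_add_stepOp M π fun s => by linarith [h s, hb1 s])

lemma occ_nonneg (M : FiniteMDP S A) (μ : stdSimplex ℝ S) (π : Policy S A) (s : S) :
    0 ≤ occ M μ π s := (μ.2.1 s).trans (occ_bounds M μ π s).1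

lemma valueAt_eq [MeasurableSpace S] [DiscreteMeasurableSpace S] [MeasurableSpace A]
    [DiscreteMeasurableSpace A] (M : FiniteMDP S A) (τ : ℝ) (μ : stdSimplex ℝ S)
    (π π' : Policy S A) :
    valueAt M τ π' μ = valueAt M τ π μ + ∑ s, occ M μ π' s * resid M τ π π' s := by
  rw [sum_occ_mul M μ π' (value_sub_value M τ π π')]
  simp only [valueAt, mul_sub, Finset.sum_sub_distrib]
  ring

end Occupancy

section Gradient

lemma hasFDerivAt_mul_of_eq_zero {E : Type*} [NormedAddCommGroup E] [NormedSpace ℝ E]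
    {c f : E → ℝ} {L : E →L[ℝ] ℝ} {x : E} (hc : ContinuousAt c x) (hf : HasFDerivAt f L x)
    (h0 : f x = 0) : HasFDerivAt (fun y => c y * f y) (c x • L) x := by
  rw [hasFDerivAt_iff_isLittleO] at hf ⊢
  have hc1 : (fun y => c y - c x) =o[nhds x] (fun _ => (1 : ℝ)) := by
    rw [Asymptotics.isLittleO_one_iff]
    simpa using hc.sub_const (c x)
  have h1 := (hc.isBigO_one ℝ).smul_isLittleO hf
  have h2 := hc1.smul_isBigO (L.isBigO_sub (nhds x) x)
  simp only [one_smul] at h1 h2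
  refine (h1.add h2).congr_left fun y => ?_
  simp only [h0, smul_apply, smul_eq_mul]
  ring

lemma euclideanSpace_proj_apply {ι : Type*} (i : ι) (v : EuclideanSpace ℝ ι) :
    (EuclideanSpace.proj i : EuclideanSpace ℝ ι →L[ℝ] ℝ) v = v i := rfl

variable {S A : Type*} [Fintype A] [Nonempty A]

lemma sum_exp_pos (θ : EuclideanSpace ℝ (S × A)) (s : S) : 0 < ∑ a, Real.exp (θ (s, a)) :=
  Finset.sum_pos (fun _ _ => Real.exp_pos _) Finset.univ_nonempty

lemma softmax_pos (θ : EuclideanSpace ℝ (S × A)) (s : S) (a : A) : 0 < (softmax θ s).1 a :=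
  div_pos (Real.exp_pos _) (sum_exp_pos θ s)

lemma log_softmax (θ : EuclideanSpace ℝ (S × A)) (s : S) (a : A) :
    Real.log ((softmax θ s).1 a) = θ (s, a) - Real.log (∑ b, Real.exp (θ (s, b))) := by
  rw [softmax, Real.log_div (Real.exp_pos _).ne' (sum_exp_pos θ s).ne', Real.log_exp]

lemma softmax_eq_reweight {θ θ' : EuclideanSpace ℝ (S × A)} {s : S} {u : A → ℝ}
    (h : ∀ a, θ' (s, a) = θ (s, a) + u a) (a : A) :
    (softmax θ' s).1 a = (softmax θ s).1 a * Real.exp (u a) /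
      ∑ b, (softmax θ s).1 b * Real.exp (u b) := by
  have hZ := (sum_exp_pos θ s).ne'
  have e : ∀ b, (softmax θ s).1 b * Real.exp (u b) =
      Real.exp (θ' (s, b)) / ∑ c, Real.exp (θ (s, c)) := fun b => by
    rw [h, Real.exp_add]
    exact div_mul_eq_mul_div _ _ _
  simp only [e, ← Finset.sum_div]
  rw [div_div_div_cancel_right₀ hZ]
  rfl

lemma continuous_softmax (s : S) (a : A) :
    Continuous fun θ : EuclideanSpace ℝ (S × A) => (softmax θ s).1 a :=
  Continuous.div (by fun_prop) (by fun_prop) fun θ => (sum_exp_pos θ s).ne'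

variable [Fintype S]

lemma hasFDerivAt_log_softmax (θ : EuclideanSpace ℝ (S × A)) (s : S) (a : A) :
    HasFDerivAt (fun θ : EuclideanSpace ℝ (S × A) => Real.log ((softmax θ s).1 a))
      ((EuclideanSpace.proj (s, a) : EuclideanSpace ℝ (S × A) →L[ℝ] ℝ) -
        ∑ b, (softmax θ s).1 b • (EuclideanSpace.proj (s, b) : EuclideanSpace ℝ (S × A) →L[ℝ] ℝ))
      θ := by
  simp only [log_softmax]
  have hp : ∀ b, HasFDerivAt (fun θ : EuclideanSpace ℝ (S × A) => θ (s, b))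
      (EuclideanSpace.proj (s, b) : EuclideanSpace ℝ (S × A) →L[ℝ] ℝ) θ := fun b =>
    (EuclideanSpace.proj (s, b) : EuclideanSpace ℝ (S × A) →L[ℝ] ℝ).hasFDerivAt
  have hs := (HasFDerivAt.fun_sum (u := Finset.univ) fun b _ => (hp b).exp).log (sum_exp_pos θ s).ne'
  refine ((hp a).sub hs).congr_fderiv ?_
  congr 1
  rw [Finset.smul_sum]
  refine Finset.sum_congr rfl fun b _ => ?_
  rw [smul_smul]
  congr 1
  exact (div_eq_inv_mul _ _).symm

variable [MeasurableSpace S] [DiscreteMeasurableSpace S] [MeasurableSpace A]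
  [DiscreteMeasurableSpace A]

lemma hasFDerivAt_resid (M : FiniteMDP S A) (τ : ℝ) (θ : EuclideanSpace ℝ (S × A)) (s : S) :
    HasFDerivAt (fun θ' : EuclideanSpace ℝ (S × A) => resid M τ (softmax θ) (softmax θ') s)
      (∑ a, ((softmax θ s).1 a * adv M τ (softmax θ) s a) •
        (EuclideanSpace.proj (s, a) : EuclideanSpace ℝ (S × A) →L[ℝ] ℝ)) θ := by
  have hl := hasFDerivAt_log_softmax θ s
  have hp : ∀ a, HasFDerivAt (fun θ : EuclideanSpace ℝ (S × A) => (softmax θ s).1 a) _ θ :=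
    fun a => ((hl a).exp).congr_of_eventuallyEq
      (Filter.Eventually.of_forall fun θ => (Real.exp_log (softmax_pos θ s a)).symm)
  have h := HasFDerivAt.fun_sum (u := Finset.univ) fun a _ => (hp a).mul
    (((hl a).const_mul τ).const_sub (adv M τ (softmax θ) s a + τ * Real.log ((softmax θ s).1 a)))
  refine h.congr_fderiv ?_
  ext v
  have h0 := sum_mul_adv M τ (softmax θ) s
  have h1 := (softmax θ s).2.2
  simp only [Real.exp_log (softmax_pos θ s _), sum_apply,
    add_apply, smul_apply, neg_apply,
    sub_apply, smul_eq_mul, euclideanSpace_proj_apply, add_sub_cancel_right]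
  set m := ∑ b, (softmax θ s).1 b * v (s, b) with hm
  calc _ = ∑ a, ((softmax θ s).1 a * adv M τ (softmax θ) s a * v (s, a)
        - ((softmax θ s).1 a * adv M τ (softmax θ) s a) * m
        - τ * ((softmax θ s).1 a * v (s, a)) + (softmax θ s).1 a * (τ * m)) :=
        Finset.sum_congr rfl fun a _ => by ring
    _ = _ := by
        rw [Finset.sum_add_distrib, Finset.sum_sub_distrib, Finset.sum_sub_distrib,
          ← Finset.sum_mul, ← Finset.mul_sum, ← Finset.sum_mul, h0, h1, ← hm]
        ring

lemma gradient_valueAt_softmax [DecidableEq S] (M : FiniteMDP S A) (τ : ℝ) (μ : stdSimplex ℝ S)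
    (θ : EuclideanSpace ℝ (S × A)) (s : S) (a : A) :
    gradient (fun θ => valueAt M τ (softmax θ) μ) θ (s, a) =
      occ M μ (softmax θ) s * ((softmax θ s).1 a * adv M τ (softmax θ) s a) := by
  classical
  have hN : ContinuousAt (fun θ : EuclideanSpace ℝ (S × A) => (bellmanMatrix M (softmax θ))⁻¹) θ := by
    have hc : Continuous fun θ : EuclideanSpace ℝ (S × A) => bellmanMatrix M (softmax θ) := by
      have h : Continuous fun θ : EuclideanSpace ℝ (S × A) =>
          Matrix.of fun s s' => ∑ a, (softmax θ s).1 a * (M.P s a).1 s' :=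
        continuous_matrix fun i j =>
          continuous_finsetSum _ fun a _ => (continuous_softmax i a).mul continuous_const
      exact continuous_const.sub (h.const_smul M.γ)
    refine ContinuousAt.comp (g := fun N : Matrix S S ℝ => N⁻¹) ?_ hc.continuousAt
    refine continuousAt_matrix_inv _ ?_
    exact NormedRing.inverse_continuousAt (isUnit_det_bellmanMatrix M (softmax θ)).unit
  have ho : ∀ s, ContinuousAt (fun θ : EuclideanSpace ℝ (S × A) => occ M μ (softmax θ) s) θ := by
    intro s
    simp only [occ, Matrix.vecMul, dotProduct]
    have h1 : ∀ t, ContinuousAt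
        (fun θ : EuclideanSpace ℝ (S × A) => (bellmanMatrix M (softmax θ))⁻¹ t s) θ := fun t =>
      ContinuousAt.comp (g := fun N : Matrix S S ℝ => N t s)
        (continuous_id.matrix_elem t s).continuousAt hN
    exact tendsto_finsetSum _ fun t _ => (h1 t).const_mul _
  have hF := (HasFDerivAt.fun_sum (u := Finset.univ) fun s _ => hasFDerivAt_mul_of_eq_zero (ho s)
    (hasFDerivAt_resid M τ θ s) (resid_self M τ (softmax θ) s)).const_add
      (valueAt M τ (softmax θ) μ)
  simp only [← valueAt_eq] at hF
  have h2 : gradient (fun θ => valueAt M τ (softmax θ) μ) θ (s, a) =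
      fderiv ℝ (fun θ => valueAt M τ (softmax θ) μ) θ (EuclideanSpace.single (s, a) 1) := by
    rw [← InnerProductSpace.toDual_symm_apply (𝕜 := ℝ)
      (y := fderiv ℝ (fun θ => valueAt M τ (softmax θ) μ) θ), EuclideanSpace.inner_single_right,
      one_mul]
    rfl
  rw [h2, hF.fderiv]
  simp only [sum_apply, smul_apply, smul_eq_mul,
    euclideanSpace_proj_apply, PiLp.single_apply, Prod.mk.injEq]
  rw [Finset.sum_eq_single s, Finset.sum_eq_single a]
  · simp
  · intro b _ hb; simp [hb]
  · simp
  · intro t _ ht; simp [ht]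
  · simp

end Gradient

section PolicyGradient

variable {S A : Type*} [Fintype S] [MeasurableSpace S] [DiscreteMeasurableSpace S]
  [Fintype A] [Nonempty A] [MeasurableSpace A] [DiscreteMeasurableSpace A]

lemma softmaxPG_succ_apply [DecidableEq S] (M : FiniteMDP S A) (τ : ℝ) (μ : stdSimplex ℝ S) (η : ℝ)
    (θ₀ : EuclideanSpace ℝ (S × A)) (k : ℕ) (s : S) (a : A) :
    softmaxPG M τ μ η θ₀ (k + 1) (s, a) = softmaxPG M τ μ η θ₀ k (s, a) +
      η * occ M μ (softmax (softmaxPG M τ μ η θ₀ k)) s *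
        ((softmax (softmaxPG M τ μ η θ₀ k) s).1 a *
          adv M τ (softmax (softmaxPG M τ μ η θ₀ k)) s a) := by
  rw [softmaxPG, PiLp.add_apply, PiLp.smul_apply, gradient_valueAt_softmax, smul_eq_mul, mul_assoc]

lemma abs_step_le [DecidableEq S] (M : FiniteMDP S A) {τ η : ℝ} (hτ : 0 < τ) (hη : 0 ≤ η)
    (μ : stdSimplex ℝ S) (π : Policy S A) (s : S) (a : A) :
    |η * occ M μ π s * ((π s).1 a * adv M τ π s a)| ≤
      η * (1 + τ * Real.log (Fintype.card A)) / (1 - M.γ) ^ 2 := by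
  have h0 := occ_nonneg M μ π s
  have hg : 0 < 1 - M.γ := by linarith [M.γ_lt_one]
  rw [abs_mul, abs_of_nonneg (mul_nonneg hη h0)]
  calc _ ≤ η * (1 / (1 - M.γ)) * ((1 + τ * Real.log (Fintype.card A)) / (1 - M.γ)) :=
        mul_le_mul (mul_le_mul_of_nonneg_left (occ_bounds M μ π s).2 hη)
          (abs_mul_adv_le M hτ π s a) (abs_nonneg _) (by positivity)
    _ = _ := by field_simp

/-- The policies of softmax policy gradient are bounded away from zero. -/
lemma exists_pos_le_softmaxPG [Nonempty S] (M : FiniteMDP S A) {τ η : ℝ} (hτ : 0 < τ) (hη : 0 ≤ η)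
    (μ : stdSimplex ℝ S) (θ₀ : EuclideanSpace ℝ (S × A)) :
    ∃ δ > 0, ∀ k s a, δ ≤ (softmax (softmaxPG M τ μ η θ₀ k) s).1 a := by
  classical
  have key : ∀ s, ∃ δ > 0, ∀ k a, δ ≤ (softmax (softmaxPG M τ μ η θ₀ k) s).1 a := fun s => by
    refine exists_pos_le_softmax_weight (x := fun k a => softmaxPG M τ μ η θ₀ k (s, a))
      (m := η * (1 + τ * Real.log (Fintype.card A)) / (1 - M.γ) ^ 2)
      (Real.exp_pos (-((1 + τ * Real.log (Fintype.card A)) / (1 - M.γ)) / τ)) ?_ ?_ ?_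
    · intro k
      simp only [softmaxPG_succ_apply, Finset.sum_add_distrib, ← Finset.mul_sum, sum_mul_adv,
        mul_zero, add_zero]
    · intro k a
      dsimp only
      rw [softmaxPG_succ_apply]
      linarith [(abs_le.1 (abs_step_le M hτ hη μ (softmax (softmaxPG M τ μ η θ₀ k)) s a)).1]
    · intro k a h
      dsimp only
      rw [softmaxPG_succ_apply]
      have hp := softmax_pos (softmaxPG M τ μ η θ₀ k) s a
      have h1 := adv_nonneg_of_lt M hτ _ s a hp h
      have h2 := mul_nonneg (mul_nonneg hη (occ_nonneg M μ (softmax (softmaxPG M τ μ η θ₀ k)) s))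
        (mul_nonneg hp.le h1)
      linarith
  choose δ hδ h using key
  obtain ⟨s₀, hs₀⟩ := Finite.exists_min δ
  exact ⟨δ s₀, hδ s₀, fun k s a => (hs₀ s).trans (h s k a)⟩

lemma le_resid_softmaxPG (M : FiniteMDP S A) {τ η : ℝ} (hτ : 0 < τ) (hη : 0 ≤ η)
    (μ : stdSimplex ℝ S) (θ₀ : EuclideanSpace ℝ (S × A)) (k : ℕ) (s : S)
    (hb : 0 ≤ 2 * Real.exp (-(2 * η * (1 + τ * Real.log (Fintype.card A)) / (1 - M.γ) ^ 2))
      - τ * η / (1 - M.γ)) :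
    η * μ.1 s / 2 * (2 * Real.exp (-(2 * η * (1 + τ * Real.log (Fintype.card A)) / (1 - M.γ) ^ 2))
        - τ * η / (1 - M.γ)) *
      ∑ a, ((softmax (softmaxPG M τ μ η θ₀ k) s).1 a *
        adv M τ (softmax (softmaxPG M τ μ η θ₀ k)) s a) ^ 2 ≤
    resid M τ (softmax (softmaxPG M τ μ η θ₀ k)) (softmax (softmaxPG M τ μ η θ₀ (k + 1))) s := by
  classical
  set π := softmax (softmaxPG M τ μ η θ₀ k)
  have ho := occ_nonneg M μ π s
  obtain ⟨ho1, ho2⟩ := occ_bounds M μ π s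
  have h1 := le_sum_reweight_sub_log hτ (π s) (softmax (softmaxPG M τ μ η θ₀ (k + 1)) s)
    (softmax_pos _ s) (sum_mul_adv M τ π s) (mul_nonneg hη ho) (abs_step_le M hτ hη μ π s)
    (softmax_eq_reweight fun a => softmaxPG_succ_apply M τ μ η θ₀ k s a)
  refine le_trans (mul_le_mul_of_nonneg_right ?_ (Finset.sum_nonneg fun a _ => sq_nonneg _)) h1
  have e : 2 * (η * (1 + τ * Real.log (Fintype.card A)) / (1 - M.γ) ^ 2)
      = 2 * η * (1 + τ * Real.log (Fintype.card A)) / (1 - M.γ) ^ 2 := by ring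
  rw [e]
  refine mul_le_mul ?_ ?_ hb (by positivity)
  · gcongr
  · have := mul_le_mul_of_nonneg_left ho2 (mul_nonneg hτ.le hη)
    rw [mul_one_div] at this
    linarith

lemma norm_optValue_sub_le (M : FiniteMDP S A) {τ c : ℝ} (hτ : 0 < τ) (hc0 : 0 ≤ c) (hc1 : c ≤ 1)
    (π π' : Policy S A) {D : S → ℝ} (hD0 : ∀ s, 0 ≤ D s)
    (hD : ∀ π₁ s, resid M τ π π₁ s ≤ D s) (hπ' : ∀ s, c * D s ≤ resid M τ π π' s) :
    ‖optValue M τ - value M τ π'‖ ≤ (1 - (1 - M.γ) * c) * ‖optValue M τ - value M τ π‖ := by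
  set δ := ‖optValue M τ - value M τ π‖ with hδ
  have hle : ∀ s, optValue M τ s - value M τ π s ≤ δ := fun s =>
    (le_abs_self _).trans (norm_le_pi_norm (optValue M τ - value M τ π) s)
  have hopt : ∀ s, optValue M τ s - value M τ π s ≤ M.γ * δ + D s := fun s => by
    rw [sub_le_iff_le_add]
    have : Nonempty (Policy S A) := ⟨π⟩
    refine ciSup_le fun π₁ => ?_
    have h1 := value_sub_value M τ π π₁ s
    have h2 := stepOp_le M π₁ (v := fun s => value M τ π₁ s - value M τ π s) (c := δ)
      (fun s => by linarith [hle s, value_le_optValue M hτ π₁ s]) s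
    linarith [hD π₁ s, mul_le_mul_of_nonneg_left h2 M.γ_nonneg]
  have himp : ∀ s, c * D s ≤ value M τ π' s - value M τ π s := fun s =>
    (hπ' s).trans (le_of_eq_add_stepOp M π' (value_sub_value M τ π π')
      (fun s => (mul_nonneg hc0 (hD0 s)).trans (hπ' s)) s)
  have hδ0 : 0 ≤ δ := norm_nonneg _
  have hγ := M.γ_nonneg
  have hγ1 := M.γ_lt_one
  refine (pi_norm_le_iff_of_nonneg (mul_nonneg (by nlinarith) hδ0)).2 fun s => ?_
  rw [Pi.sub_apply, Real.norm_of_nonneg (sub_nonneg.2 (value_le_optValue M hτ π' s))]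
  nlinarith [mul_le_mul_of_nonneg_left (hopt s) hc0,
    mul_le_mul_of_nonneg_left (hle s) (sub_nonneg.2 hc1), himp s]

end PolicyGradient

end EntropyPG
end

theorem theorem6p9 {S A : Type*}
    [Fintype S] [Nonempty S] [MeasurableSpace S] [DiscreteMeasurableSpace S]
    [Fintype A] [Nonempty A] [MeasurableSpace A] [DiscreteMeasurableSpace A]
    (M : EntropyPG.FiniteMDP S A) (τ : ℝ) (hτ : 0 < τ) :
    ∃ β : ℝ,
      -- `β` is the unique root of the step size equation
      (∀ x : ℝ,
        Real.exp (-(2 * x * (1 + τ * Real.log (Fintype.card A)) / (1 - M.γ) ^ 2))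
          = τ * x / (2 * (1 - M.γ)) ↔ x = β) ∧
      -- the previously known range of step sizes is `(0, 2α]`
      2 * ((1 - M.γ) ^ 3 / (8 + τ * (4 + 8 * Real.log (Fintype.card A)))) < β ∧
      ∀ μ : stdSimplex ℝ S, (∀ s, 0 < μ.1 s) →
      ∀ η : ℝ, 0 < η → η < β →
      ∀ θ₀ : EuclideanSpace ℝ (S × A),
      ∀ π : ℕ → EntropyPG.Policy S A,
        (∀ k, π k = EntropyPG.softmax (EntropyPG.softmaxPG M τ μ η θ₀ k)) →
      ∀ κ ϱ : ℝ,
        κ = (⨅ k : ℕ, ⨅ s : S, ⨅ a : A, (π k s).1 a) →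
        ϱ = 1 - (1 - M.γ) * η * (⨅ s : S, μ.1 s) * τ * κ ^ 2 *
          (2 * Real.exp (-(2 * η * (1 + τ * Real.log (Fintype.card A)) / (1 - M.γ) ^ 2))
            - τ * η / (1 - M.γ)) →
        0 < κ ∧ 0 < ϱ ∧ ϱ < 1 ∧
        ∀ k : ℕ,
          ‖EntropyPG.optValue M τ - EntropyPG.value M τ (π k)‖
            ≤ ϱ ^ k * ‖EntropyPG.optValue M τ - EntropyPG.value M τ (π 0)‖ := by
  have hg : 0 < 1 - M.γ := by linarith [M.γ_lt_one]
  have hL : 0 ≤ Real.log (Fintype.card A) := Real.log_natCast_nonneg _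
  obtain ⟨β, hβ, hβlt⟩ := EntropyPG.existsUnique_exp_neg_eq
    (c := 2 * (1 + τ * Real.log (Fintype.card A)) / (1 - M.γ) ^ 2) (d := τ / (2 * (1 - M.γ)))
    (by positivity) (by positivity)
  have e1 : ∀ x : ℝ, 2 * x * (1 + τ * Real.log (Fintype.card A)) / (1 - M.γ) ^ 2 =
      2 * (1 + τ * Real.log (Fintype.card A)) / (1 - M.γ) ^ 2 * x := fun x => by ring
  have e2 : ∀ x : ℝ, τ * x / (2 * (1 - M.γ)) = τ / (2 * (1 - M.γ)) * x := fun x => by ring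
  refine ⟨β, fun x => by rw [e1, e2]; exact hβ x,
    (hβlt _).1 (EntropyPG.two_mul_step_lt hτ M.γ_nonneg M.γ_lt_one hL), ?_⟩
  intro μ hμ η hη hηβ θ₀ π hπ κ ϱ hκ hϱ
  set E := Real.exp (-(2 * η * (1 + τ * Real.log (Fintype.card A)) / (1 - M.γ) ^ 2)) with hE
  have hb : 0 < 2 * E - τ * η / (1 - M.γ) := by
    have h := (hβlt η).2 hηβ
    rw [← e1, ← e2, ← hE] at h
    have e3 : τ * η / (1 - M.γ) = 2 * (τ * η / (2 * (1 - M.γ))) := by field_simp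
    linarith
  have hE0 : 0 < E := Real.exp_pos _
  have hE1 : E < 1 := (Real.exp_lt_exp.2 (neg_lt_zero.2 (by positivity))).trans_eq Real.exp_zero
  set m := ⨅ s, μ.1 s with hm
  obtain ⟨s₀, hs₀⟩ := exists_eq_ciInf_of_finite (f := fun s => μ.1 s)
  have hm0 : 0 < m := (hμ s₀).trans_eq hs₀
  have hmle : ∀ s, m ≤ μ.1 s := fun s => ciInf_le (Set.finite_range _).bddBelow s
  have hm1 : m ≤ 1 := hs₀.symm.trans_le (EntropyPG.stdSimplex_le_one μ s₀)
  obtain ⟨δ, hδ, hδle⟩ := EntropyPG.exists_pos_le_softmaxPG M hτ hη.le μ θ₀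
  have hκ0 : 0 < κ := hκ ▸ hδ.trans_le
    (le_ciInf fun k => le_ciInf fun s => le_ciInf fun a => hπ k ▸ hδle k s a)
  have hκle : ∀ k s a, κ ≤ (π k s).1 a := fun k s a => by
    rw [hκ]
    refine (ciInf_le ⟨0, ?_⟩ k).trans ((ciInf_le (Set.finite_range _).bddBelow s).trans
      (ciInf_le (Set.finite_range _).bddBelow a))
    rintro _ ⟨k, rfl⟩
    exact le_ciInf fun s => le_ciInf fun a => (π k s).2.1 a
  have hκ1 : κ ≤ 1 := (hκle 0 s₀ (Classical.arbitrary A)).trans (EntropyPG.stdSimplex_le_one _ _)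
  set c := m * κ ^ 2 * (η * τ * (2 * E - τ * η / (1 - M.γ))) with hc
  have hX : 0 < η * τ * (2 * E - τ * η / (1 - M.γ)) := mul_pos (mul_pos hη hτ) hb
  have hc0 : 0 < c := mul_pos (by positivity) hX
  have hc1 : c < 1 := by
    have h1 := EntropyPG.step_mul_lt_one (τ := τ) (η := η) hg (by linarith [M.γ_nonneg]) hE0 hE1
    have h2 : m * κ ^ 2 ≤ 1 := mul_le_one₀ hm1 (by positivity) (pow_le_one₀ hκ0.le hκ1)
    nlinarith
  have hϱc : ϱ = 1 - (1 - M.γ) * c := by rw [hϱ, hc]; ring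
  have hϱ0 : 0 < ϱ := by rw [hϱc]; nlinarith [M.γ_nonneg]
  refine ⟨hκ0, hϱ0, by rw [hϱc]; linarith [mul_pos hg hc0], fun k => ?_⟩
  induction k with
  | zero => simp
  | succ k ih =>
    have h1 := EntropyPG.norm_optValue_sub_le M hτ hc0.le hc1.le (π k) (π (k + 1))
      (D := fun s => (∑ a, ((π k s).1 a * EntropyPG.adv M τ (π k) s a) ^ 2) / (2 * τ * κ ^ 2))
      (fun s => by positivity)
      (fun π₁ s => EntropyPG.resid_le M hτ hκ0 (π k) π₁ s (hκle k s))
      (fun s => by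
        have h2 := EntropyPG.le_resid_softmaxPG M hτ hη.le μ θ₀ k s hb.le
        rw [← hπ, ← hπ] at h2
        refine le_trans ?_ h2
        have h3 : c * ((∑ a, ((π k s).1 a * EntropyPG.adv M τ (π k) s a) ^ 2) / (2 * τ * κ ^ 2))
            = η * m / 2 * (2 * E - τ * η / (1 - M.γ)) *
              ∑ a, ((π k s).1 a * EntropyPG.adv M τ (π k) s a) ^ 2 := by
          rw [hc]
          field_simp
        rw [h3]
        have h4 : 0 ≤ ∑ a, ((π k s).1 a * EntropyPG.adv M τ (π k) s a) ^ 2 :=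
          Finset.sum_nonneg fun a _ => sq_nonneg _
        gcongr
        exact hmle s)
    rw [← hϱc] at h1
    calc _ ≤ _ := h1
      _ ≤ ϱ * (ϱ ^ k * _) := mul_le_mul_of_nonneg_left ih hϱ0.le
      _ = _ := by ring
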